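/- Consider a parallel network: a nonempty finite set $E$ of edges from a source $s$ to a destination $d$, where edge $e$ has an integer transit cost $\tau_e\ge 0$ and an integer capacity $\gamma_e\ge 1$, and where $E$ is totally ordered by $\prec$ in such a way that $e\prec f$ implies $\tau_e\le\tau_f$. Let $\delta$ be an integer with $1\le\delta\le\sum_{e\in E}\gamma_e$. Starting from an empty network, at each stage $t=1,2,\dots$ a generation of $\delta$ players, ordered by priority, departs from $s$, and each of them chooses an edge. A player who chooses $e$ at stage $t$ reaches the head of $e$ at stage $t+\tau_e$ and joins a queue there, in which players are ordered by time of arrival and then by priority; at each stage the first $\gamma_e$ players of the queue (all of them, if there are fewer) exit and arrive at $d$. The latency $\ell_{it}(\sigma)$ of the $i$-th player of generation $t$ under the strategy profile $\sigma$ is $\tau_e$ plus the number of stages that she waits in the queue. Let $\bar L_T(\sigma)=\frac1T\sum_{t=1}^{T}\sum_{i=1}^{\delta}\ell_{it}(\sigma)$, and let $N^e_t(\sigma)$ be the number of players who choose $e$ at stage $t$. A profile $\sigma$ is optimal if $\limsup_T\bar L_T(\sigma)\le\liminf_T\bar L_T(\sigma')$ for all profiles $\sigma'$; the optimal latency $\mathsf{Opt}$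 is the common value of $\liminf_T\bar L_T(\sigma)$ and $\limsup_T\bar L_T(\sigma)$ for optimal $\sigma$. A uniformly fastest route (UFR) equilibrium is a Nash equilibrium $\sigma$ (no player can decrease her latency by a unilateral change of edge) in which no player can, by a unilateral change of edge, arrive earlier at a vertex of her route; the worst equilibrium latency $\mathsf{WEq}$ is the supremum of $\limsup_T\bar L_T(\sigma)$ over all UFR equilibria $\sigma$. Then there is a unique edge $f_\delta\in E$ with $\sum_{e\prec f_\delta}\gamma_e<\delta\le\gamma_{f_\delta}+\sum_{e\prec f_\delta}\gamma_e$. Optimal profiles exist, and $$\mathsf{Opt}=\sum_{e\prec f_\delta}\gamma_e\tau_e+\Bigl(\delta-\sum_{e\prec f_\delta}\gamma_e\Bigr)\tau_{f_\delta},\qquad \mathsf{WEq}=\delta\,\tau_{f_\delta}.$$ Moreover, there are an optimal profile $\sigma^{\mathsf{Opt}}$, a UFR equilibrium $\sigma^{\mathsf{WEq}}$ with $\limsup_T\bar L_T(\sigma^{\mathsf{WEq}})=\mathsf{WEq}$, and a stage $t_0$ such that for all $t\ge t_0$ $$N^e_t(\sigma^{\mathsf{Opt}})=N^e_t(\sigma^{\mathsf{WEq}})=\gamma_e\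 \text{ for all } e\prec f_\delta,\qquad N^{f_\delta}_t(\sigma^{\mathsf{Opt}})=N^{f_\delta}_t(\sigma^{\mathsf{WEq}})=\delta-\sum_{e\prec f_\delta}\gamma_e .$$ -/

import Mathlib

/-- A parallel network: finitely many parallel edges (the type `E`), all going from the source
`s` to the destination `d`, each with a free-flow transit cost `τ e` and a capacity `γ e`.
Every route consists of a single edge, so routes are identified with edges. -/
structure ParallelNetwork (E : Type*) where
  /-- free-flow transit cost -/
  τ : E → ℕ
  /-- capacity: the maximal number of players that can exit the edge at the same stage -/
  γ : E → ℕ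
  γ_pos : ∀ e, 0 < γ e

/-- The two vertices of a parallel network. -/
inductive ParallelVertex where
  | source
  | destination

namespace ParallelNetwork

/-- Players of the game with uniform inflow `δ`. The player `(t, i)` is the `i`-th player of the
generation that departs from the source at stage `t`. Stages are numbered `0, 1, 2, …`, and the
players of one generation are numbered `0, …, δ - 1` in order of decreasing priority. -/
abbrev Player (δ : ℕ) : Type := ℕ × Fin δ

/-- A strategy profile assigns a route (an edge) to each player. -/
abbrev Profile (δ : ℕ) (E : Type*) : Type _ := Player δ → E

variable {E : Type*} {δ : ℕ}

/-- The capacity of the network. The only cut of a parallel network is the set of all edges. -/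
def capacity [Fintype E] (N : ParallelNetwork E) : ℕ := ∑ e, N.γ e

variable [DecidableEq E]

/-- The number of players who choose edge `e` at stage `t`. -/
def numChoosing (σ : Profile δ E) (e : E) (t : ℕ) : ℕ :=
  (Finset.univ.filter fun i : Fin δ => σ (t, i) = e).card

/-- The number of players who reach the head of edge `e` at stage `u`, that is, who entered `e`
at stage `u - τ e`. -/
def numReachingHead (N : ParallelNetwork E) (σ : Profile δ E) (e : E) (u : ℕ) : ℕ :=
  if N.τ e ≤ u then numChoosing σ e (u - N.τ e) else 0

/-- The number of players in the queue at the head of edge `e` just before stage `u`: those who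
reached the head before stage `u` and have not exited before stage `u`. The network is empty at
the beginning, and at each stage the first `γ e` players of the queue exit (all of them, if there
are at most `γ e`); the truncated subtraction is intended. -/
def queue (N : ParallelNetwork E) (σ : Profile δ E) (e : E) : ℕ → ℕ
  | 0 => 0
  | u + 1 => queue N σ e u + numReachingHead N σ e u - N.γ e

/-- The number of players that are ahead of player `p` when she reaches the head of the edge that
she has chosen: those still in the queue who entered the edge before her, and those who entered
the edge together with her and have priority over her. -/
def numAhead (N : ParallelNetwork E) (σ : Profile δ E) (p : Player δ) : ℕ :=
  queue N σ (σ p) (p.1 + N.τ (σ p)) +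
    (Finset.univ.filter fun j : Fin δ => j < p.2 ∧ σ (p.1, j) = σ p).card

/-- The waiting cost of player `p`: as long as there are at least `γ` players ahead of her, the
first `γ` of them exit and she waits for one stage; as soon as there are fewer than `γ` players
ahead of her, she exits. The number of stages that she waits is the integer quotient of the number
of players ahead of her by `γ`. -/
def waitingCost (N : ParallelNetwork E) (σ : Profile δ E) (p : Player δ) : ℕ :=
  N.numAhead σ p / N.γ (σ p)

/-- The latency of player `p`: transit cost plus waiting cost. -/
def latency (N : ParallelNetwork E) (σ : Profile δ E) (p : Player δ) : ℕ :=
  N.τ (σ p) + N.waitingCost σ p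

/-- The total latency of the generation that departs at stage `t`. -/
def totalLatency (N : ParallelNetwork E) (σ : Profile δ E) (t : ℕ) : ℕ :=
  ∑ i : Fin δ, N.latency σ (t, i)

/-- The average total latency over the first `T` stages. -/
noncomputable def averageLatency (N : ParallelNetwork E) (σ : Profile δ E) (T : ℕ) : ℝ :=
  (∑ t ∈ Finset.range T, (N.totalLatency σ t : ℝ)) / T

/-- The limit superior, in the extended reals, of the average total latencies. -/
noncomputable def limsupLatency (N : ParallelNetwork E) (σ : Profile δ E) : EReal :=
  Filter.limsup (fun T : ℕ => (N.averageLatency σ T : EReal)) Filter.atTop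

/-- The limit inferior, in the extended reals, of the average total latencies. -/
noncomputable def liminfLatency (N : ParallelNetwork E) (σ : Profile δ E) : EReal :=
  Filter.liminf (fun T : ℕ => (N.averageLatency σ T : EReal)) Filter.atTop

/-- Socially optimal strategy profiles. -/
def IsOptimal (N : ParallelNetwork E) (σ : Profile δ E) : Prop :=
  ∀ σ' : Profile δ E, N.limsupLatency σ ≤ N.liminfLatency σ'

/-- The optimal latency `Opt(N, δ)` exists and equals `L`: there is an optimal profile, and for
every optimal profile the limits inferior and superior of the average total latencies are `L`. -/
def IsOptLatency (N : ParallelNetwork E) (δ : ℕ) (L : EReal) : Prop :=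
  (∃ σ : Profile δ E, N.IsOptimal σ) ∧
    ∀ σ : Profile δ E, N.IsOptimal σ → N.liminfLatency σ = L ∧ N.limsupLatency σ = L

/-- Nash equilibria: no player can decrease her latency by changing her route. -/
def IsNash (N : ParallelNetwork E) (σ : Profile δ E) : Prop :=
  ∀ (p : Player δ) (e : E), N.latency σ p ≤ N.latency (Function.update σ p e) p

/-- The stage at which player `p` arrives at a vertex (both vertices are on every route). -/
def arrivalTime (N : ParallelNetwork E) (σ : Profile δ E) (p : Player δ) : ParallelVertex → ℕ
  | .source => p.1
  | .destination => p.1 + N.latency σ p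

/-- Uniformly fastest route equilibria: Nash equilibria in which no player can arrive earlier at a
vertex of her route by choosing an alternative route. -/
def IsUFREquilibrium (N : ParallelNetwork E) (σ : Profile δ E) : Prop :=
  N.IsNash σ ∧ ∀ (p : Player δ) (v : ParallelVertex),
    ¬ ∃ e : E, N.arrivalTime (Function.update σ p e) p v < N.arrivalTime σ p v

/-- The worst equilibrium latency `WEq(N, δ)`. -/
noncomputable def worstEquilibriumLatency (N : ParallelNetwork E) (δ : ℕ) : EReal :=
  ⨆ (σ : Profile δ E) (_ : N.IsUFREquilibrium σ), N.limsupLatency σ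

end ParallelNetwork

namespace ParallelNetwork

variable {E : Type*} [Fintype E] [LinearOrder E]

/-- The total capacity of the edges that strictly precede `f`. -/
def capacityBefore (N : ParallelNetwork E) (f : E) : ℕ :=
  ∑ e ∈ Finset.univ.filter (fun e => e < f), N.γ e

/-- The defining property of the edge `f_δ`: the capacity of the edges strictly before it is less
than `δ`, and that of the edges up to and including it is at least `δ`. -/
def IsCriticalEdge (N : ParallelNetwork E) (δ : ℕ) (f : E) : Prop :=
  N.capacityBefore f < δ ∧ δ ≤ ∑ e ∈ Finset.univ.filter (fun e => e ≤ f), N.γ e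

end ParallelNetwork

/-! A player's latency depends only on her edge `e` and the number `x` of players ahead of her at
its head: it is `τ e + x / γ e`. Each edge thus offers positions of increasing latency, and in a
Nash equilibrium each player in turn takes a cheapest free one.

Optimum: credit a position of latency `c` with the profit `τ f - c`, truncated at 0. Summed over a
generation, the profits telescope to the change of a potential of the queues, up to what service
removes, at most `γ e * (τ f - τ e)` per edge and stage. The potential is bounded, so
`sum_totalLatency_ge` yields the long-run lower bound, which `exists_fillingProfile` attains without
any waiting.

Worst equilibrium: by `IsNash.latency_le`, the positions of latency at most `τ f` on edges `e ≤ f`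
never run out, so nobody pays more than `τ f`. The bound is attained by breaking ties towards
earlier edges. Queues then grow monotonically (`IsLexGreedy.headQueue_mono`), hence become
stationary on the edges up to `f`. At that point every edge before `f` has a queue costing at least
`τ f - τ e`, so that everyone pays at least `τ f` (`IsLexGreedy.of_stationary`). -/

namespace ParallelNetwork

/-! ### Queues indexed by the stage of entry, and latencies after a deviation. -/

section Queues

variable {E : Type*} {δ : ℕ}

/-- The latency of a player on edge `e` who has `x` players ahead of her. -/
def cost (N : ParallelNetwork E) (e : E) (x : ℕ) : ℕ := N.τ e + x / N.γ e

theorem cost_mono (N : ParallelNetwork E) (e : E) : Monotone (N.cost e) := fun _ _ h =>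
  Nat.add_le_add_left (Nat.div_le_div_right h) _
variable [DecidableEq E]

/-- The queue that the players entering edge `e` at stage `t` find when they reach its head. -/
def headQueue (N : ParallelNetwork E) (σ : Profile δ E) (e : E) (t : ℕ) : ℕ :=
  N.queue σ e (t + N.τ e)

/-- The number of players of generation `t`, among the first `i`, who choose `e`, added to the
queue that they find at the head of `e`. -/
def occupancy (N : ParallelNetwork E) (σ : Profile δ E) (e : E) (t i : ℕ) : ℕ :=
  N.headQueue σ e t + (Finset.univ.filter fun j : Fin δ => (j : ℕ) < i ∧ σ (t, j) = e).card

theorem queue_eq_zero_of_le (N : ParallelNetwork E) (σ : Profile δ E) (e : E) {u : ℕ}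
    (h : u ≤ N.τ e) : N.queue σ e u = 0 := by
  induction u with
  | zero => rfl
  | succ u ih =>
    have h' : ¬ N.τ e ≤ u := by omega
    simp [queue, numReachingHead, h', ih (by omega)]

@[simp]
theorem headQueue_zero (N : ParallelNetwork E) (σ : Profile δ E) (e : E) :
    N.headQueue σ e 0 = 0 :=
  N.queue_eq_zero_of_le σ e (by omega)

/-- All players who enter `e` together reach its head together, so indexing the queue by the stage
of entry removes `τ e` from the recursion. -/
theorem headQueue_succ (N : ParallelNetwork E) (σ : Profile δ E) (e : E) (t : ℕ) :
    N.headQueue σ e (t + 1) = N.headQueue σ e t + numChoosing σ e t - N.γ e := by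
  have h : t + 1 + N.τ e = t + N.τ e + 1 := by omega
  simp [headQueue, h, queue, numReachingHead]

theorem headQueue_congr (N : ParallelNetwork E) {σ σ' : Profile δ E} (e : E) {t : ℕ}
    (h : ∀ s < t, ∀ j, σ (s, j) = σ' (s, j)) : N.headQueue σ e t = N.headQueue σ' e t := by
  induction t with
  | zero => simp
  | succ t ih =>
    rw [headQueue_succ, headQueue_succ, ih fun s hs => h s (by omega)]
    simp [numChoosing, h t (by omega)]

@[simp]
theorem occupancy_zero (N : ParallelNetwork E) (σ : Profile δ E) (e : E) (t : ℕ) :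
    N.occupancy σ e t 0 = N.headQueue σ e t := by
  simp [occupancy]

theorem occupancy_succ (N : ParallelNetwork E) (σ : Profile δ E) (e : E) (t : ℕ) (i : Fin δ) :
    N.occupancy σ e t (i + 1) = N.occupancy σ e t i + if σ (t, i) = e then 1 else 0 := by
  unfold occupancy
  rw [add_assoc]
  congr 1
  split_ifs with h
  · rw [← Finset.card_insert_of_notMem (a := i) (by simp)]
    congr 1
    ext j
    simp only [Finset.mem_filter, Finset.mem_univ, true_and, Finset.mem_insert]
    constructor
    · rintro ⟨h1, h2⟩
      rcases Nat.lt_succ_iff_lt_or_eq.mp h1 with h3 | h3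
      · exact Or.inr ⟨h3, h2⟩
      · exact Or.inl (Fin.ext h3)
    · rintro (rfl | ⟨h1, h2⟩)
      · exact ⟨by omega, h⟩
      · exact ⟨by omega, h2⟩
  · rw [add_zero]
    congr 1
    ext j
    simp only [Finset.mem_filter, Finset.mem_univ, true_and]
    constructor
    · rintro ⟨h1, h2⟩
      refine ⟨lt_of_le_of_ne (by omega) fun h3 => h ?_, h2⟩
      rwa [← Fin.ext h3]
    · rintro ⟨h1, h2⟩
      exact ⟨by omega, h2⟩

theorem occupancy_mono (N : ParallelNetwork E) (σ : Profile δ E) (e : E) (t : ℕ) :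
    Monotone (N.occupancy σ e t) := by
  intro i j hij
  refine Nat.add_le_add_left (Finset.card_le_card ?_) _
  intro k
  simp only [Finset.mem_filter, Finset.mem_univ, true_and]
  exact fun h => ⟨by omega, h.2⟩

theorem occupancy_last (N : ParallelNetwork E) (σ : Profile δ E) (e : E) (t : ℕ) :
    N.occupancy σ e t δ = N.headQueue σ e t + numChoosing σ e t := by
  simp [occupancy, numChoosing]

theorem headQueue_succ_eq_occupancy (N : ParallelNetwork E) (σ : Profile δ E) (e : E) (t : ℕ) :
    N.headQueue σ e (t + 1) = N.occupancy σ e t δ - N.γ e := by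
  rw [headQueue_succ, occupancy_last]

theorem headQueue_le_occupancy (N : ParallelNetwork E) (σ : Profile δ E) (e : E) (t i : ℕ) :
    N.headQueue σ e t ≤ N.occupancy σ e t i :=
  Nat.le_add_right _ _

theorem sum_numChoosing [Fintype E] (σ : Profile δ E) (t : ℕ) :
    ∑ e, numChoosing σ e t = δ := by
  simpa [numChoosing] using
    (Finset.card_eq_sum_card_fiberwise (s := (Finset.univ : Finset (Fin δ))) (t := Finset.univ)
      (f := fun i => σ (t, i)) (by simp)).symm

theorem latency_eq_cost (N : ParallelNetwork E) (σ : Profile δ E) (t : ℕ) (i : Fin δ) :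
    N.latency σ (t, i) = N.cost (σ (t, i)) (N.occupancy σ (σ (t, i)) t i) := rfl

/-- The players ahead of `(t, i)` belong to earlier generations or have higher priority in her own;
her deviation affects neither their choices nor the queue that they form. -/
theorem latency_update (N : ParallelNetwork E) (σ : Profile δ E) (t : ℕ) (i : Fin δ) (e : E) :
    N.latency (Function.update σ (t, i) e) (t, i) = N.cost e (N.occupancy σ e t i) := by
  rw [latency_eq_cost, Function.update_self, occupancy, occupancy,
    N.headQueue_congr (σ := Function.update σ (t, i) e) (σ' := σ)]
  · congr 3
    ext j
    simp only [Finset.mem_filter, Finset.mem_univ, true_and]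
    refine and_congr_right fun h => ?_
    rw [Function.update_of_ne]
    intro h'
    simp only [Prod.mk.injEq, true_and] at h'
    rw [h'] at h
    exact lt_irrefl _ h
  · intro s hs j
    rw [Function.update_of_ne]
    intro h'
    simp only [Prod.mk.injEq] at h'
    omega

theorem isNash_iff (N : ParallelNetwork E) (σ : Profile δ E) :
    N.IsNash σ ↔ ∀ (t : ℕ) (i : Fin δ) (e : E),
      N.cost (σ (t, i)) (N.occupancy σ (σ (t, i)) t i) ≤ N.cost e (N.occupancy σ e t i) := by
  simp only [IsNash, Prod.forall, latency_update]
  rfl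

theorem isUFREquilibrium_iff_isNash (N : ParallelNetwork E) (σ : Profile δ E) :
    N.IsUFREquilibrium σ ↔ N.IsNash σ := by
  refine ⟨fun h => h.1, fun h => ⟨h, ?_⟩⟩
  rintro p (_ | _) ⟨e, he⟩
  · exact lt_irrefl _ he
  · exact absurd (h p e) (not_le.mpr (Nat.lt_of_add_lt_add_left he))

end Queues

/-! ### From bounds on partial sums to bounds on limiting averages. -/

section Averages

variable {E : Type*} {δ : ℕ} [DecidableEq E]

theorem le_liminfLatency_of_le_sum (N : ParallelNetwork E) (σ : Profile δ E) (c K : ℝ)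
    (h : ∀ T : ℕ, T * c - K ≤ ∑ t ∈ Finset.range T, (N.totalLatency σ t : ℝ)) :
    (c : EReal) ≤ N.liminfLatency σ := by
  have hlim : Filter.Tendsto (fun T : ℕ => ((c - K / T : ℝ) : EReal)) Filter.atTop
      (nhds (c : EReal)) := by
    refine (continuous_coe_real_ereal.tendsto c).comp ?_
    simpa using (tendsto_const_nhds (x := c)).sub (tendsto_const_div_atTop_nhds_zero_nat K)
  rw [← hlim.liminf_eq]
  refine Filter.liminf_le_liminf ?_
  filter_upwards [Filter.eventually_gt_atTop 0] with T hT
  have hT' : (0 : ℝ) < T := by exact_mod_cast hT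
  rw [EReal.coe_le_coe_iff, averageLatency, le_div_iff₀ hT']
  calc (c - K / T) * T = T * c - K := by field_simp
    _ ≤ _ := h T

theorem limsupLatency_le_of_totalLatency_le (N : ParallelNetwork E) (σ : Profile δ E) (c : ℝ)
    (h : ∀ t, (N.totalLatency σ t : ℝ) ≤ c) : N.limsupLatency σ ≤ c := by
  refine Filter.limsup_le_of_le (by isBoundedDefault) ?_
  filter_upwards [Filter.eventually_gt_atTop 0] with T hT
  have hT' : (0 : ℝ) < T := by exact_mod_cast hT
  rw [EReal.coe_le_coe_iff, averageLatency, div_le_iff₀ hT']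
  calc _ ≤ ∑ _t ∈ Finset.range T, c := Finset.sum_le_sum fun t _ => h t
    _ = c * T := by simp [mul_comm]

theorem liminfLatency_le_limsupLatency (N : ParallelNetwork E) (σ : Profile δ E) :
    N.liminfLatency σ ≤ N.limsupLatency σ :=
  Filter.liminf_le_limsup

end Averages

/-! ### The lower bound for arbitrary profiles. -/

section LowerBound

variable {E : Type*} {δ : ℕ} [DecidableEq E] [Fintype E]

/-- Summing over the players of a generation amounts to summing, edge by edge, over the positions
that they take in the queues. -/
theorem sum_players_eq_sum_positions (N : ParallelNetwork E) (σ : Profile δ E) (t : ℕ)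
    (g : E → ℕ → ℤ) :
    ∑ i : Fin δ, g (σ (t, i)) (N.occupancy σ (σ (t, i)) t i) =
      ∑ e, ∑ x ∈ Finset.range (N.occupancy σ e t δ), g e x -
        ∑ e, ∑ x ∈ Finset.range (N.headQueue σ e t), g e x := by
  set a : ℕ → ℤ := fun k => ∑ e, ∑ x ∈ Finset.range (N.occupancy σ e t k), g e x with ha
  have hstep : ∀ i : Fin δ,
      g (σ (t, i)) (N.occupancy σ (σ (t, i)) t i) = a (i + 1) - a i := by
    intro i
    simp only [ha, ← Finset.sum_sub_distrib]
    rw [Finset.sum_eq_single (σ (t, i))]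
    · rw [occupancy_succ, if_pos rfl, Finset.sum_range_succ]
      ring
    · intro e _ he
      rw [occupancy_succ, if_neg he.symm]
      simp
    · simp
  simp_rw [hstep]
  rw [Fin.sum_univ_eq_sum_range (fun k => a (k + 1) - a k) δ, Finset.sum_range_sub]
  simp [ha]

/-- Only the first `γ * D` positions contribute. The bound does not depend on `x`, which keeps the
potential bounded even if queues grow without limit. -/
theorem sum_range_truncated_le (γ D x : ℕ) (hγ : 0 < γ) :
    ∑ y ∈ Finset.range x, (D - y / γ) ≤ γ * D * D := by
  have hle : ∀ y, D - y / γ ≤ if y < γ * D then D else 0 := by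
    intro y
    split_ifs with h
    · exact Nat.sub_le _ _
    · have : D ≤ y / γ := (Nat.le_div_iff_mul_le hγ).mpr (by rw [mul_comm]; omega)
      exact (Nat.sub_eq_zero_of_le this).le
  calc _ ≤ ∑ y ∈ Finset.range x, if y < γ * D then D else 0 := Finset.sum_le_sum fun y _ => hle y
    _ = ((Finset.range x).filter (· < γ * D)).card * D := by
      rw [← Finset.sum_filter, Finset.sum_const, smul_eq_mul]
    _ ≤ (Finset.range (γ * D)).card * D := by
      refine Nat.mul_le_mul_right _ (Finset.card_le_card fun y => ?_)
      simp
    _ = _ := by simp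

theorem sum_range_truncated_le_add (γ D x : ℕ) :
    ∑ y ∈ Finset.range x, (D - y / γ) ≤ ∑ y ∈ Finset.range (x - γ), (D - y / γ) + γ * D := by
  rw [← Finset.sum_range_add_sum_Ico _ (Nat.sub_le x γ)]
  refine Nat.add_le_add_left ?_ _
  calc _ ≤ ∑ _y ∈ Finset.Ico (x - γ) x, D := Finset.sum_le_sum fun y _ => Nat.sub_le _ _
    _ = (x - (x - γ)) * D := by simp
    _ ≤ γ * D := Nat.mul_le_mul_right _ (by omega)

/-- Charging each player the price `L` and crediting each edge with the resulting profit of its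
capacity bounds the total latency from below, for every profile. -/
theorem sum_totalLatency_ge (N : ParallelNetwork E) (σ : Profile δ E) (L T : ℕ) :
    T * (δ * L) ≤ ∑ t ∈ Finset.range T, N.totalLatency σ t + T * ∑ e, N.γ e * (L - N.τ e) +
      ∑ e, N.γ e * (L - N.τ e) * (L - N.τ e) := by
  -- The potential: the total profit, at price `L`, of the positions occupied by the queues that
  -- generation `t` finds.
  set H : ℕ → ℕ := fun t =>
    ∑ e, ∑ x ∈ Finset.range (N.headQueue σ e t), (L - N.τ e - x / N.γ e) with hH
  have hstep : ∀ t, δ * L + H t ≤ N.totalLatency σ t + H (t + 1) + ∑ e, N.γ e * (L - N.τ e) := by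
    intro t
    have h1 := N.sum_players_eq_sum_positions σ t
      (fun e x => ((L - N.τ e - x / N.γ e : ℕ) : ℤ))
    have h2 : δ * L ≤ N.totalLatency σ t + ∑ i : Fin δ, (L - N.τ (σ (t, i)) -
        N.occupancy σ (σ (t, i)) t i / N.γ (σ (t, i))) := by
      rw [totalLatency, ← Finset.sum_add_distrib]
      calc δ * L = ∑ _i : Fin δ, L := by simp
        _ ≤ _ := Finset.sum_le_sum fun i _ => by rw [latency_eq_cost, cost]; omega
    have h3 : ∑ e, ∑ x ∈ Finset.range (N.occupancy σ e t δ), (L - N.τ e - x / N.γ e) ≤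
        H (t + 1) + ∑ e, N.γ e * (L - N.τ e) := by
      rw [hH, ← Finset.sum_add_distrib]
      refine Finset.sum_le_sum fun e _ => ?_
      rw [headQueue_succ_eq_occupancy]
      exact sum_range_truncated_le_add _ _ _
    have h4 : ∑ i : Fin δ, (L - N.τ (σ (t, i)) -
        N.occupancy σ (σ (t, i)) t i / N.γ (σ (t, i))) + H t =
        ∑ e, ∑ x ∈ Finset.range (N.occupancy σ e t δ), (L - N.τ e - x / N.γ e) := by
      zify
      rw [h1]
      simp [hH]
    omega
  have hsum : T * (δ * L) ≤
      ∑ t ∈ Finset.range T, N.totalLatency σ t + T * ∑ e, N.γ e * (L - N.τ e) + H T := by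
    induction T with
    | zero => simp
    | succ T ih =>
      have := hstep T
      rw [Finset.sum_range_succ, add_mul, add_mul, one_mul, one_mul]
      omega
  refine hsum.trans (Nat.add_le_add_left (Finset.sum_le_sum fun e _ => ?_) _)
  exact sum_range_truncated_le _ _ _ (N.γ_pos e)

end LowerBound

/-! ### Greedy choices with ties broken by the order of the edges. -/

section Order

variable {E : Type*} {δ : ℕ} [LinearOrder E]

theorem sum_occupancy_le (N : ParallelNetwork E) (σ : Profile δ E) (A : Finset E) (t : ℕ)
    {i : ℕ} (hi : i ≤ δ) :
    ∑ e ∈ A, N.occupancy σ e t i ≤ ∑ e ∈ A, N.headQueue σ e t + i := by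
  induction i with
  | zero => simp
  | succ i ih =>
    have hstep : ∑ e ∈ A, N.occupancy σ e t (i + 1) ≤ ∑ e ∈ A, N.occupancy σ e t i + 1 := by
      simp only [N.occupancy_succ σ _ t ⟨i, hi⟩, Finset.sum_add_distrib, Finset.sum_ite_eq]
      split_ifs <;> simp
    have := ih (by omega)
    omega

/-- The latency of the next slot on an edge, with ties broken in favour of earlier edges. -/
def lexCost (N : ParallelNetwork E) (e : E) (x : ℕ) : ℕ ×ₗ E := toLex (N.cost e x, e)

theorem lexCost_mono (N : ParallelNetwork E) (e : E) : Monotone (N.lexCost e) := fun _ _ h =>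
  Prod.Lex.toLex_mono (Prod.mk_le_mk.mpr ⟨N.cost_mono e h, le_rfl⟩)

theorem lexCost_le_iff (N : ParallelNetwork E) (e e' : E) (x x' : ℕ) :
    N.lexCost e x ≤ N.lexCost e' x' ↔
      N.cost e x < N.cost e' x' ∨ N.cost e x = N.cost e' x' ∧ e ≤ e' :=
  Prod.Lex.toLex_le_toLex

/-- Every player chooses the earliest of the edges that minimize her latency. -/
def IsLexGreedy (N : ParallelNetwork E) (σ : Profile δ E) : Prop :=
  ∀ (t : ℕ) (i : Fin δ) (e : E),
    N.lexCost (σ (t, i)) (N.occupancy σ (σ (t, i)) t i) ≤ N.lexCost e (N.occupancy σ e t i)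

theorem IsLexGreedy.isNash {N : ParallelNetwork E} {σ : Profile δ E} (h : N.IsLexGreedy σ) :
    N.IsNash σ := by
  rw [isNash_iff]
  intro t i e
  rcases (N.lexCost_le_iff _ _ _ _).mp (h t i e) with h | h
  · exact h.le
  · exact h.1.le

/-- The last slot taken on an edge that is used precedes all free slots. -/
theorem IsLexGreedy.lexCost_le {N : ParallelNetwork E} {σ : Profile δ E} (h : N.IsLexGreedy σ)
    {t : ℕ} {e : E} (he : 0 < numChoosing σ e t) (e' : E) :
    N.lexCost e (N.occupancy σ e t δ - 1) ≤ N.lexCost e' (N.occupancy σ e' t δ) := by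
  -- Induction over the players of the generation: the last one to join `e` preferred its slot to
  -- the next slot of `e'`, and later choices only raise the cost of the latter.
  have key : ∀ i ≤ δ, N.headQueue σ e t < N.occupancy σ e t i →
      N.lexCost e (N.occupancy σ e t i - 1) ≤ N.lexCost e' (N.occupancy σ e' t i) := by
    intro i hi
    induction i with
    | zero => simp
    | succ i ih =>
      intro hlt
      have hmono := N.lexCost_mono e' (N.occupancy_mono σ e' t (Nat.le_succ i))
      have hs := N.occupancy_succ σ e t ⟨i, hi⟩
      dsimp only at hs
      split_ifs at hs with hc
      · rw [hs, Nat.add_sub_cancel]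
        refine le_trans ?_ hmono
        have := h t ⟨i, hi⟩ e'
        rwa [hc] at this
      · rw [add_zero] at hs
        rw [hs] at hlt ⊢
        exact (ih (by omega) hlt).trans hmono
  refine key δ le_rfl ?_
  rw [occupancy_last]
  omega

end Order

/-! ### The critical edge and the upper bound for equilibria. -/

section Equilibria

variable {E : Type*} {δ : ℕ} [Fintype E] [LinearOrder E]

theorem capacityBefore_add (N : ParallelNetwork E) (f : E) :
    N.capacityBefore f + N.γ f = ∑ e ∈ Finset.univ.filter (fun e => e ≤ f), N.γ e := by
  have h : Finset.univ.filter (fun e => e ≤ f) =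
      insert f (Finset.univ.filter fun e => e < f) := by
    ext e
    simp [le_iff_eq_or_lt]
  rw [h, Finset.sum_insert (by simp), capacityBefore, add_comm]

theorem existsUnique_isCriticalEdge (N : ParallelNetwork E) (hδ_pos : 0 < δ)
    (hδ_le : δ ≤ N.capacity) : ∃! f : E, N.IsCriticalEdge δ f := by
  set S : Finset E := Finset.univ.filter fun f => δ ≤ ∑ e ∈ Finset.univ.filter (· ≤ f), N.γ e
  have hne : (Finset.univ : Finset E).Nonempty := by
    by_contra h
    rw [Finset.not_nonempty_iff_eq_empty] at h
    rw [capacity, h, Finset.sum_empty] at hδ_le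
    omega
  have hS : S.Nonempty := by
    refine ⟨Finset.univ.max' hne, ?_⟩
    simp only [S, Finset.mem_filter, Finset.mem_univ, true_and]
    rw [Finset.filter_true_of_mem fun e he => Finset.le_max' _ e he]
    exact hδ_le
  have hmin := Finset.min'_mem S hS
  set f := S.min' hS with hf
  have hfc : N.IsCriticalEdge δ f := by
    refine ⟨?_, by simpa [S] using hmin⟩
    -- If the edges before `f` had capacity at least `δ`, the immediate predecessor `g` of `f` would
    -- be in `S`, against minimality; if there is none, `0 < δ` suffices.
    rcases (Finset.univ.filter fun e => e < f).eq_empty_or_nonempty with h | h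
    · simpa [capacityBefore, h] using hδ_pos
    · by_contra hcap
      set g := (Finset.univ.filter fun e => e < f).max' h with hg
      have hgf : g < f := (Finset.mem_filter.mp (Finset.max'_mem _ h)).2
      have heq : Finset.univ.filter (fun e => e < f) = Finset.univ.filter (fun e => e ≤ g) := by
        ext e
        simp only [Finset.mem_filter, Finset.mem_univ, true_and]
        exact ⟨fun he => Finset.le_max' _ e (by simpa using he), fun he => he.trans_lt hgf⟩
      have hgS : g ∈ S := by
        simp only [S, Finset.mem_filter, Finset.mem_univ, true_and]
        rw [← heq]
        exact not_lt.mp hcap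
      exact (Finset.min'_le S g hgS).not_gt hgf
  have key : ∀ a b : E, N.IsCriticalEdge δ a → N.IsCriticalEdge δ b → ¬ a < b := by
    intro a b ha hb hab
    refine absurd ha.2 (not_le.mpr (lt_of_le_of_lt ?_ hb.1))
    refine Finset.sum_le_sum_of_subset fun e => ?_
    simp only [Finset.mem_filter, Finset.mem_univ, true_and]
    exact fun he => he.trans_lt hab
  exact ⟨f, hfc, fun g hg =>
    le_antisymm (not_lt.mp (key f g hfc hg)) (not_lt.mp (key g f hg hfc))⟩

/-- In a Nash equilibrium, the slots of latency at most `τ f` on the edges up to the critical edge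
suffice for every generation. -/
theorem IsNash.latency_le (N : ParallelNetwork E) (hτ : Monotone N.τ) {f : E}
    (hf : N.IsCriticalEdge δ f) {σ : Profile δ E} (hσ : N.IsNash σ) (t : ℕ) :
    (∀ e ≤ f, N.headQueue σ e t ≤ N.γ e * (N.τ f - N.τ e)) ∧
      ∀ i, N.latency σ (t, i) ≤ N.τ f := by
  rw [isNash_iff] at hσ
  set A : Finset E := Finset.univ.filter fun e => e ≤ f with hA
  -- Edge `e` has `γ e * (τ f - τ e + 1)` positions of latency at most `τ f`, of which the queue
  -- leaves at least `γ e` free. In total at least `δ` are free, so one remains for every player.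
  have hgen : ∀ t, (∀ e ≤ f, N.headQueue σ e t ≤ N.γ e * (N.τ f - N.τ e)) →
      ∀ i, N.latency σ (t, i) ≤ N.τ f := by
    intro t hq i
    obtain ⟨e, he, hlt⟩ : ∃ e ≤ f, N.occupancy σ e t i < N.γ e * (N.τ f - N.τ e + 1) := by
      by_contra! hcon
      have h1 := N.sum_occupancy_le σ A t i.2.le
      have h2 : ∑ e ∈ A, (N.headQueue σ e t + N.γ e) ≤ ∑ e ∈ A, N.occupancy σ e t i := by
        refine Finset.sum_le_sum fun e he => ?_
        have he' : e ≤ f := by simpa [hA] using he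
        refine le_trans ?_ (hcon e he')
        rw [mul_add, mul_one]
        exact Nat.add_le_add_right (hq e he') _
      rw [Finset.sum_add_distrib] at h2
      have h3 : δ ≤ ∑ e ∈ A, N.γ e := hf.2
      omega
    rw [latency_eq_cost]
    refine (hσ t i e).trans ?_
    have h1 : N.occupancy σ e t i / N.γ e < N.τ f - N.τ e + 1 :=
      Nat.div_lt_of_lt_mul hlt
    have h2 := hτ he
    rw [cost]
    omega
  have hq : ∀ t, ∀ e ≤ f, N.headQueue σ e t ≤ N.γ e * (N.τ f - N.τ e) := by
    intro t
    induction t with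
    | zero => simp
    | succ t ih =>
      intro e he
      have hlat := hgen t ih
      -- No player takes a position of latency above `τ f`; serving `γ e` players then restores the
      -- bound on the queue.
      have hocc : ∀ i ≤ δ, N.occupancy σ e t i ≤ N.γ e * (N.τ f - N.τ e + 1) := by
        intro i hi
        induction i with
        | zero =>
          rw [occupancy_zero]
          exact (ih e he).trans (Nat.mul_le_mul_left _ (Nat.le_succ _))
        | succ i ihi =>
          rw [N.occupancy_succ σ e t ⟨i, hi⟩]
          split_ifs with hc
          · have h1 := hlat ⟨i, hi⟩
            rw [latency_eq_cost, hc, cost] at h1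
            have h2 : N.occupancy σ e t i / N.γ e < N.τ f - N.τ e + 1 := by
              dsimp only at h1
              omega
            rw [Nat.div_lt_iff_lt_mul (N.γ_pos e), mul_comm] at h2
            exact h2
          · exact ihi (by omega)
      rw [headQueue_succ_eq_occupancy, Nat.sub_le_iff_le_add]
      exact (hocc δ le_rfl).trans (by rw [mul_add, mul_one])
  exact ⟨hq t, hgen t (hq t)⟩

theorem IsNash.limsupLatency_le (N : ParallelNetwork E) (hτ : Monotone N.τ) {f : E}
    (hf : N.IsCriticalEdge δ f) {σ : Profile δ E} (hσ : N.IsNash σ) :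
    N.limsupLatency σ ≤ (((δ : ℝ) * (N.τ f : ℝ) : ℝ) : EReal) := by
  refine N.limsupLatency_le_of_totalLatency_le σ _ fun t => ?_
  have h : N.totalLatency σ t ≤ δ * N.τ f := by
    rw [totalLatency]
    calc _ ≤ ∑ _i : Fin δ, N.τ f := Finset.sum_le_sum fun i _ => (hσ.latency_le N hτ hf t).2 i
      _ = _ := by simp
  exact_mod_cast h

/-! ### A worst equilibrium and its stationary regime. -/

theorem exists_lexCost_min [Nonempty E] (N : ParallelNetwork E) (X : E → ℕ) :
    ∃ e, ∀ e', N.lexCost e (X e) ≤ N.lexCost e' (X e') := by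
  obtain ⟨e, -, he⟩ := Finset.exists_min_image Finset.univ (fun e => N.lexCost e (X e))
    Finset.univ_nonempty
  exact ⟨e, fun e' => he e' (Finset.mem_univ _)⟩

/-- Greediness refers to occupancies, which depend on the profile itself. To avoid the circularity,
the dynamics run on abstract occupancy vectors, the profile is read off, and its occupancies are
checked to agree. -/
theorem exists_isLexGreedy [Nonempty E] (N : ParallelNetwork E) (δ : ℕ) :
    ∃ σ : Profile δ E, N.IsLexGreedy σ := by
  choose pick hpick using N.exists_lexCost_min
  let next (X : E → ℕ) : E → ℕ := fun e => X e + if pick X = e then 1 else 0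
  let fill (q : E → ℕ) (i : ℕ) : E → ℕ := next^[i] q
  let queues (t : ℕ) : E → ℕ := (fun q e => fill q δ e - N.γ e)^[t] 0
  let σ : Profile δ E := fun p => pick (fill (queues p.1) p.2)
  have hfill : ∀ t, (∀ e, N.headQueue σ e t = queues t e) →
      ∀ i ≤ δ, ∀ e, N.occupancy σ e t i = fill (queues t) i e := by
    intro t hq i hi
    induction i with
    | zero => simpa [fill] using hq
    | succ i ih =>
      intro e
      have h : fill (queues t) (i + 1) = next (fill (queues t) i) :=
        Function.iterate_succ_apply' _ _ _
      rw [N.occupancy_succ σ e t ⟨i, hi⟩, h]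
      dsimp only [next]
      rw [← ih (by omega) e]
  have hqueues : ∀ t e, N.headQueue σ e t = queues t e := by
    intro t
    induction t with
    | zero => simp [queues]
    | succ t ih =>
      intro e
      have h : queues (t + 1) e = fill (queues t) δ e - N.γ e := by
        dsimp only [queues]
        rw [Function.iterate_succ_apply']
      rw [headQueue_succ_eq_occupancy, hfill t ih δ le_rfl, h]
  refine ⟨σ, fun t i e => ?_⟩
  rw [hfill t (hqueues t) i i.2.le, hfill t (hqueues t) i i.2.le]
  exact hpick _ e

theorem IsLexGreedy.headQueue_mono {N : ParallelNetwork E} {σ : Profile δ E}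
    (h : N.IsLexGreedy σ) (e : E) : Monotone (N.headQueue σ e) := by
  have hstep : ∀ t, (∀ e, N.headQueue σ e t ≤ N.headQueue σ e (t + 1)) →
      ∀ e, N.occupancy σ e t δ ≤ N.occupancy σ e (t + 1) δ := by
    intro t hq e
    -- With a longer initial queue but a smaller final occupancy, `e` attracts fewer players than
    -- before, so some other edge `e'` attracts more.
    by_contra! hlt
    have hqe := hq e
    have hlast := N.occupancy_last σ e t
    have hlast' := N.occupancy_last σ e (t + 1)
    have hle : ∀ e', numChoosing σ e' (t + 1) ≤ numChoosing σ e' t := by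
      intro e'
      rcases Nat.eq_zero_or_pos (numChoosing σ e' (t + 1)) with h0 | hpos
      · omega
      have h1 := N.occupancy_last σ e' t
      have h2 := N.occupancy_last σ e' (t + 1)
      have hqe' := hq e'
      by_contra! hlt'
      have hne : e' ≠ e := by
        rintro rfl
        omega
      have h3 : N.lexCost e' (N.occupancy σ e' t δ) ≤
          N.lexCost e' (N.occupancy σ e' (t + 1) δ - 1) := N.lexCost_mono e' (by omega)
      have h4 := h.lexCost_le hpos e
      have h5 : N.lexCost e (N.occupancy σ e (t + 1) δ) ≤
          N.lexCost e (N.occupancy σ e t δ - 1) := N.lexCost_mono e (by omega)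
      have h6 := h.lexCost_le (t := t) (e := e) (by omega) e'
      -- Greediness at stage `t + 1` and at stage `t` gives opposite inequalities between these two
      -- slots. Equal lexicographic costs force equal edges.
      have h7 : N.lexCost e' (N.occupancy σ e' t δ) = N.lexCost e (N.occupancy σ e t δ - 1) :=
        le_antisymm (h3.trans (h4.trans h5)) h6
      exact hne (congrArg (fun p => (ofLex p).2) h7)
    have hsum := Finset.sum_lt_sum (fun e' _ => hle e') ⟨e, Finset.mem_univ e, by omega⟩
    rw [sum_numChoosing, sum_numChoosing] at hsum
    exact lt_irrefl _ hsum
  have hall : ∀ t e, N.headQueue σ e t ≤ N.headQueue σ e (t + 1) := by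
    intro t
    induction t with
    | zero => simp
    | succ t ih =>
      intro e
      rw [headQueue_succ_eq_occupancy, headQueue_succ_eq_occupancy N σ e (t + 1)]
      exact Nat.sub_le_sub_right (hstep t ih e) _
  exact monotone_nat_of_le_succ fun t => hall t e

theorem eventually_const_of_monotone_of_le {q : ℕ → ℕ} (hq : Monotone q) {B : ℕ}
    (hB : ∀ t, q t ≤ B) : ∀ᶠ t in Filter.atTop, q (t + 1) = q t := by
  have hbdd : BddAbove (Set.range q) := ⟨B, by rintro _ ⟨t, rfl⟩; exact hB t⟩
  obtain ⟨t₀, ht₀⟩ := Nat.sSup_mem (Set.range_nonempty q) hbdd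
  filter_upwards [Filter.eventually_ge_atTop t₀] with t ht
  have h1 : q (t + 1) ≤ q t₀ := ht₀ ▸ le_csSup hbdd ⟨t + 1, rfl⟩
  exact le_antisymm (h1.trans (hq ht)) (hq (Nat.le_succ t))

/-- Flows and latencies of a lexicographically greedy profile at a stage at which the queues up
to the critical edge are stationary. -/
theorem IsLexGreedy.of_stationary {N : ParallelNetwork E} (hτ : Monotone N.τ) {f : E}
    (hf : N.IsCriticalEdge δ f) {σ : Profile δ E} (h : N.IsLexGreedy σ) {t : ℕ}
    (hstat : ∀ e ≤ f, N.headQueue σ e (t + 1) = N.headQueue σ e t) :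
    (∀ e < f, numChoosing σ e t = N.γ e) ∧ numChoosing σ f t + N.capacityBefore f = δ ∧
      ∀ i, N.τ f ≤ N.latency σ (t, i) := by
  -- A stationary queue receives exactly `γ e` players if it is nonempty, and at most `γ e` if it is
  -- empty.
  have hle : ∀ e ≤ f, numChoosing σ e t ≤ N.γ e := by
    intro e he
    have h1 := hstat e he
    rw [headQueue_succ] at h1
    have := N.γ_pos e
    omega
  have hsplit : ∑ e ∈ Finset.univ.filter (fun e => e < f), numChoosing σ e t +
      ∑ e ∈ Finset.univ.filter (fun e => ¬ e < f), numChoosing σ e t = δ := by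
    rw [Finset.sum_filter_add_sum_filter_not, sum_numChoosing]
  obtain ⟨e₁, he₁, hpos₁⟩ : ∃ e, f ≤ e ∧ 0 < numChoosing σ e t := by
    by_contra! hcon
    have h1 : ∑ e ∈ Finset.univ.filter (fun e => ¬ e < f), numChoosing σ e t = 0 :=
      Finset.sum_eq_zero fun e he => Nat.le_zero.mp (hcon e (by simpa using he))
    have h2 : ∑ e ∈ Finset.univ.filter (fun e => e < f), numChoosing σ e t ≤
        N.capacityBefore f :=
      Finset.sum_le_sum fun e he => hle e (by simpa using (Finset.mem_filter.mp he).2.le)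
    have h3 := hf.1
    omega
  -- Someone took a slot of latency at least `τ f` on `e₁ ≥ f`. As ties favour `e`, its next free
  -- slot must cost strictly more than `τ f`, whence the `+ 1`.
  have hfull : ∀ e < f, N.γ e * (N.τ f - N.τ e + 1) ≤ N.occupancy σ e t δ := by
    intro e he
    have h1 := h.lexCost_le hpos₁ e
    have h2 : N.τ f ≤ N.cost e₁ (N.occupancy σ e₁ t δ - 1) :=
      (hτ he₁).trans (Nat.le_add_right _ _)
    have h3 : N.τ f < N.cost e (N.occupancy σ e t δ) := by
      rcases (N.lexCost_le_iff _ _ _ _).mp h1 with h4 | h4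
      · omega
      · exact absurd (h4.2.trans_lt he) (not_lt.mpr he₁)
    rw [mul_comm, ← Nat.le_div_iff_mul_le (N.γ_pos e)]
    rw [cost] at h3
    have := hτ he.le
    omega
  have hqueue : ∀ e < f, numChoosing σ e t = N.γ e ∧
      N.γ e * (N.τ f - N.τ e) ≤ N.headQueue σ e t := by
    intro e he
    have h1 := hfull e he
    rw [mul_add, mul_one] at h1
    have h2 := hstat e he.le
    rw [headQueue_succ_eq_occupancy] at h2
    rw [occupancy_last] at h1 h2
    generalize N.γ e * (N.τ f - N.τ e) = a at h1 ⊢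
    constructor <;> omega
  have hbefore : ∑ e ∈ Finset.univ.filter (fun e => e < f), numChoosing σ e t =
      N.capacityBefore f :=
    Finset.sum_congr rfl fun e he => (hqueue e (by simpa using he)).1
  refine ⟨fun e he => (hqueue e he).1, ?_, fun i => ?_⟩
  -- A player beyond `f` means that `f` has at least `γ f` occupants. By stationarity `f` then
  -- receives `γ f` players, and the edges up to `f` already account for all `δ`.
  · have hafter : ∀ e, f < e → numChoosing σ e t = 0 := by
      intro e he
      by_contra hne
      have h1 := h.lexCost_le (Nat.pos_of_ne_zero hne) f
      have h2 : N.γ f ≤ N.occupancy σ f t δ := by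
        by_contra! hlt
        have h3 : N.cost f (N.occupancy σ f t δ) = N.τ f := by
          rw [cost, Nat.div_eq_of_lt hlt, add_zero]
        have h4 : N.τ f ≤ N.cost e (N.occupancy σ e t δ - 1) :=
          (hτ he.le).trans (Nat.le_add_right _ _)
        rcases (N.lexCost_le_iff _ _ _ _).mp h1 with h5 | h5
        · omega
        · exact absurd h5.2 (not_le.mpr he)
      have h3 : numChoosing σ f t = N.γ f := by
        have h4 := hstat f le_rfl
        rw [headQueue_succ_eq_occupancy] at h4
        rw [occupancy_last] at h2 h4
        have := hle f le_rfl
        omega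
      have h4 : numChoosing σ f t + numChoosing σ e t ≤
          ∑ e ∈ Finset.univ.filter (fun e => ¬ e < f), numChoosing σ e t := by
        rw [← Finset.sum_pair (f := fun x => numChoosing σ x t) he.ne]
        refine Finset.sum_le_sum_of_subset fun x => ?_
        simp only [Finset.mem_insert, Finset.mem_singleton, Finset.mem_filter, Finset.mem_univ,
          true_and, not_lt]
        rintro (rfl | rfl)
        exacts [le_rfl, he.le]
      have h5 := N.capacityBefore_add f
      have h6 := hf.2
      omega
    have h1 : ∑ e ∈ Finset.univ.filter (fun e => ¬ e < f), numChoosing σ e t =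
        numChoosing σ f t := by
      refine Finset.sum_eq_single_of_mem f (by simp) fun e he hne => hafter e ?_
      exact lt_of_le_of_ne (by simpa using he) hne.symm
    omega
  · rw [latency_eq_cost, cost]
    rcases lt_or_ge (σ (t, i)) f with he | he
    · have h1 := (hqueue _ he).2.trans (N.headQueue_le_occupancy σ (σ (t, i)) t i)
      rw [mul_comm, ← Nat.le_div_iff_mul_le (N.γ_pos _)] at h1
      omega
    · exact (hτ he).trans (Nat.le_add_right _ _)

/-- The queues up to `f` are monotone and bounded by `IsNash.latency_le`; finiteness of `E` gives a
common stage. -/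
theorem IsLexGreedy.eventually_stationary {N : ParallelNetwork E} (hτ : Monotone N.τ) {f : E}
    (hf : N.IsCriticalEdge δ f) {σ : Profile δ E} (h : N.IsLexGreedy σ) :
    ∃ t₀, ∀ t ≥ t₀, ∀ e ≤ f, N.headQueue σ e (t + 1) = N.headQueue σ e t := by
  rw [← Filter.eventually_atTop, Filter.eventually_all]
  intro e
  by_cases he : e ≤ f
  · filter_upwards [eventually_const_of_monotone_of_le (h.headQueue_mono e)
      fun t => (h.isNash.latency_le N hτ hf t).1 e he] with t ht _
    exact ht
  · exact Filter.Eventually.of_forall fun t h' => absurd h' he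

theorem IsLexGreedy.le_liminfLatency {N : ParallelNetwork E} (hτ : Monotone N.τ) {f : E}
    (hf : N.IsCriticalEdge δ f) {σ : Profile δ E} (h : N.IsLexGreedy σ) :
    (((δ : ℝ) * (N.τ f : ℝ) : ℝ) : EReal) ≤ N.liminfLatency σ := by
  obtain ⟨t₀, ht₀⟩ := h.eventually_stationary hτ hf
  -- The constant covers the `t₀` generations before stationarity.
  refine N.le_liminfLatency_of_le_sum σ _ (t₀ * (δ * N.τ f)) fun T => ?_
  have hnat : T * (δ * N.τ f) ≤
      ∑ t ∈ Finset.range T, N.totalLatency σ t + t₀ * (δ * N.τ f) := by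
    induction T with
    | zero => simp
    | succ T ih =>
      rcases lt_or_ge T t₀ with hT | hT
      · exact (Nat.mul_le_mul_right _ hT).trans (Nat.le_add_left _ _)
      · have h1 : δ * N.τ f ≤ N.totalLatency σ T := by
          rw [totalLatency]
          calc δ * N.τ f = ∑ _i : Fin δ, N.τ f := by simp
            _ ≤ _ := Finset.sum_le_sum fun i _ => (h.of_stationary hτ hf (ht₀ T hT)).2.2 i
        rw [Finset.sum_range_succ, add_mul, one_mul]
        omega
  rw [sub_le_iff_le_add]
  exact_mod_cast hnat

end Equilibria

/-! ### The value of the optimum and a profile attaining it. -/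

section Optimum

variable {E : Type*} {δ : ℕ} [Fintype E] [LinearOrder E]

/-- The total transit cost of `δ` players who fill the capacities of the edges in order, up to
the edge `f`. -/
noncomputable def fillingCost (N : ParallelNetwork E) (δ : ℕ) (f : E) : ℝ :=
  (∑ e ∈ Finset.univ.filter (fun e => e < f), (N.γ e : ℝ) * (N.τ e : ℝ)) +
    ((δ : ℝ) - (N.capacityBefore f : ℝ)) * (N.τ f : ℝ)

/-- This is the form in which the price argument delivers the bound; edges after `f` drop out
because the subtraction is truncated. -/
theorem fillingCost_eq (N : ParallelNetwork E) (hτ : Monotone N.τ) (δ : ℕ) (f : E) :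
    N.fillingCost δ f = δ * N.τ f - ((∑ e, N.γ e * (N.τ f - N.τ e) : ℕ) : ℝ) := by
  have h : ∑ e, N.γ e * (N.τ f - N.τ e) =
      ∑ e ∈ Finset.univ.filter (fun e => e < f), N.γ e * (N.τ f - N.τ e) := by
    refine (Finset.sum_subset (Finset.subset_univ _) fun e _ he => ?_).symm
    have he' : f ≤ e := by simpa using he
    rw [Nat.sub_eq_zero_of_le (hτ he'), mul_zero]
  have h' : ((∑ e ∈ Finset.univ.filter (fun e => e < f), N.γ e * (N.τ f - N.τ e) : ℕ) : ℝ) =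
      ∑ e ∈ Finset.univ.filter (fun e => e < f), ((N.γ e : ℝ) * N.τ f - N.γ e * N.τ e) := by
    push_cast
    refine Finset.sum_congr rfl fun e he => ?_
    rw [Nat.cast_sub (hτ (by simpa using (Finset.mem_filter.mp he).2.le)), mul_sub]
  rw [h, h', Finset.sum_sub_distrib, ← Finset.sum_mul, fillingCost, capacityBefore]
  push_cast
  ring

theorem fillingCost_le_liminfLatency (N : ParallelNetwork E) (hτ : Monotone N.τ) (f : E)
    (σ : Profile δ E) : (N.fillingCost δ f : EReal) ≤ N.liminfLatency σ := by
  refine N.le_liminfLatency_of_le_sum σ _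
    ((∑ e, N.γ e * (N.τ f - N.τ e) * (N.τ f - N.τ e) : ℕ) : ℝ) fun T => ?_
  have h : (T : ℝ) * (δ * N.τ f) ≤ ∑ t ∈ Finset.range T, (N.totalLatency σ t : ℝ) +
      T * ((∑ e, N.γ e * (N.τ f - N.τ e) : ℕ) : ℝ) +
      ((∑ e, N.γ e * (N.τ f - N.τ e) * (N.τ f - N.τ e) : ℕ) : ℝ) := by
    exact_mod_cast N.sum_totalLatency_ge σ (N.τ f) T
  rw [fillingCost_eq N hτ, mul_sub]
  linarith

theorem exists_forall_card_fiber_eq (n : E → ℕ) (hn : ∑ e, n e = δ) :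
    ∃ c : Fin δ → E, ∀ e, (Finset.univ.filter fun i => c i = e).card = n e := by
  obtain ⟨φ⟩ : Nonempty (Fin δ ≃ Σ e, Fin (n e)) :=
    Fintype.card_eq.mp (by simp [hn])
  refine ⟨fun i => (φ i).1, fun e => ?_⟩
  rw [← Fintype.card_subtype, Fintype.card_congr (β := Fin (n e)), Fintype.card_fin]
  exact (φ.subtypeEquiv (q := fun x => x.1 = e) fun i => Iff.rfl).trans
    (Equiv.sigmaSubtype e)

/-- If the players fill the capacities of the edges in order, nobody ever waits. -/
theorem exists_fillingProfile (N : ParallelNetwork E) {f : E} (hf : N.IsCriticalEdge δ f) :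
    ∃ σ : Profile δ E, (∀ t, (N.totalLatency σ t : ℝ) = N.fillingCost δ f) ∧
      ∀ t, (∀ e < f, numChoosing σ e t = N.γ e) ∧
        numChoosing σ f t + N.capacityBefore f = δ := by
  set n : E → ℕ := fun e => (if e < f then N.γ e else 0) +
    if e = f then δ - N.capacityBefore f else 0 with hn
  have hcap : N.capacityBefore f < δ := hf.1
  have hsum : ∑ e, n e = δ := by
    rw [Finset.sum_add_distrib, ← Finset.sum_filter, Finset.sum_ite_eq' Finset.univ f]
    rw [if_pos (Finset.mem_univ f)]
    exact Nat.add_sub_of_le hcap.le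
  have hle : ∀ e, n e ≤ N.γ e := by
    intro e
    rcases lt_trichotomy e f with h | rfl | h
    · simp [hn, h, h.ne]
    · have h1 := N.capacityBefore_add e
      have h2 := hf.2
      simp only [hn, lt_irrefl, if_false, if_true]
      omega
    · simp [hn, h.not_gt, h.ne']
  obtain ⟨c, hc⟩ := exists_forall_card_fiber_eq n hsum
  set σ : Profile δ E := fun p => c p.2
  have hnum : ∀ e t, numChoosing σ e t = n e := fun e _ => hc e
  have hq : ∀ e t, N.headQueue σ e t = 0 := by
    intro e t
    induction t with
    | zero => simp
    | succ t ih =>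
      rw [headQueue_succ, ih, hnum, zero_add]
      exact Nat.sub_eq_zero_of_le (hle e)
  -- The queue is empty, and fewer than `n e ≤ γ e` players of the same generation are ahead, so the
  -- quotient vanishes.
  have hlat : ∀ t i, N.latency σ (t, i) = N.τ (c i) := by
    intro t i
    have h1 : N.occupancy σ (c i) t i < N.occupancy σ (c i) t (i + 1) := by
      rw [occupancy_succ, if_pos rfl]
      exact Nat.lt_succ_self _
    have h2 := N.occupancy_mono σ (c i) t (show (i : ℕ) + 1 ≤ δ from i.2)
    rw [occupancy_last, hq, hnum, zero_add] at h2
    change N.τ (c i) + N.occupancy σ (c i) t i / N.γ (c i) = _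
    rw [Nat.div_eq_of_lt (h1.trans_le (h2.trans (hle _))), add_zero]
  refine ⟨σ, fun t => ?_, fun t => ⟨fun e he => ?_, ?_⟩⟩
  · have h1 : N.totalLatency σ t = ∑ e, n e * N.τ e := by
      simp only [totalLatency, hlat]
      rw [← Finset.sum_fiberwise Finset.univ c]
      refine Finset.sum_congr rfl fun e _ => ?_
      rw [Finset.sum_congr rfl fun i hi => by rw [(Finset.mem_filter.mp hi).2],
        Finset.sum_const, hc, smul_eq_mul]
    have h2 : ∑ e, n e * N.τ e =
        ∑ e ∈ Finset.univ.filter (fun e => e < f), N.γ e * N.τ e +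
          (δ - N.capacityBefore f) * N.τ f := by
      simp [hn, add_mul, Finset.sum_add_distrib, ite_mul, Finset.sum_filter]
    rw [h1, h2, fillingCost]
    push_cast [hcap.le]
    ring
  · simp [hnum, hn, he, he.ne]
  · rw [hnum]
    simp only [hn, lt_irrefl, if_false, if_true]
    omega

end Optimum

end ParallelNetwork

/-! ### The theorem. -/

theorem theorem2 {E : Type*} [Fintype E] [LinearOrder E] (N : ParallelNetwork E)
    (hτ : Monotone N.τ) (δ : ℕ) (hδ_pos : 0 < δ) (hδ_le : δ ≤ N.capacity) :
    (∃! f : E, N.IsCriticalEdge δ f) ∧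
    ∀ f : E, N.IsCriticalEdge δ f →
      -- the optimal latency
      N.IsOptLatency δ
        (((∑ e ∈ Finset.univ.filter (fun e => e < f), (N.γ e : ℝ) * (N.τ e : ℝ)) +
          ((δ : ℝ) - (N.capacityBefore f : ℝ)) * (N.τ f : ℝ) : ℝ) : EReal) ∧
      -- the worst equilibrium latency
      N.worstEquilibriumLatency δ = (((δ : ℝ) * (N.τ f : ℝ) : ℝ) : EReal) ∧
      -- the eventual flows of an optimal profile and of a worst equilibrium
      ∃ σOpt σWEq : ParallelNetwork.Profile δ E,
        N.IsOptimal σOpt ∧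
        N.IsUFREquilibrium σWEq ∧ N.limsupLatency σWEq = N.worstEquilibriumLatency δ ∧
        ∃ t₀ : ℕ, ∀ t : ℕ, t₀ ≤ t →
          (∀ e : E, e < f →
            ParallelNetwork.numChoosing σOpt e t = N.γ e ∧
            ParallelNetwork.numChoosing σWEq e t = N.γ e) ∧
          (ParallelNetwork.numChoosing σOpt f t : ℤ) = (δ : ℤ) - (N.capacityBefore f : ℤ) ∧
          (ParallelNetwork.numChoosing σWEq f t : ℤ) = (δ : ℤ) - (N.capacityBefore f : ℤ) := by
  refine ⟨N.existsUnique_isCriticalEdge hδ_pos hδ_le, fun f hf => ?_⟩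
  have : Nonempty E := ⟨f⟩
  obtain ⟨σ₁, hcost, hflow⟩ := N.exists_fillingProfile hf
  have hsup : N.limsupLatency σ₁ ≤ (N.fillingCost δ f : EReal) :=
    N.limsupLatency_le_of_totalLatency_le σ₁ _ fun t => (hcost t).le
  have hopt : N.IsOptimal σ₁ := fun σ' => hsup.trans (N.fillingCost_le_liminfLatency hτ f σ')
  obtain ⟨σ₂, hlex⟩ := N.exists_isLexGreedy δ
  have hufr : N.IsUFREquilibrium σ₂ := (N.isUFREquilibrium_iff_isNash σ₂).mpr hlex.isNash
  have hlim : N.limsupLatency σ₂ = (((δ : ℝ) * (N.τ f : ℝ) : ℝ) : EReal) :=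
    le_antisymm (hlex.isNash.limsupLatency_le N hτ hf)
      ((hlex.le_liminfLatency hτ hf).trans (N.liminfLatency_le_limsupLatency σ₂))
  have hweq : N.worstEquilibriumLatency δ = (((δ : ℝ) * (N.τ f : ℝ) : ℝ) : EReal) :=
    le_antisymm (iSup₂_le fun σ hσ => hσ.1.limsupLatency_le N hτ hf)
      (hlim ▸ le_iSup₂_of_le σ₂ hufr le_rfl)
  refine ⟨⟨⟨σ₁, hopt⟩, fun σ hσ => ?_⟩, hweq, σ₁, σ₂, hopt, hufr, hlim.trans hweq.symm, ?_⟩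
  -- Any optimal profile is squeezed between the universal lower bound and comparison with `σ₁`.
  · have h1 : N.limsupLatency σ ≤ (N.fillingCost δ f : EReal) :=
      (hσ σ₁).trans ((N.liminfLatency_le_limsupLatency σ₁).trans hsup)
    have h2 := N.fillingCost_le_liminfLatency hτ f σ
    have h3 := N.liminfLatency_le_limsupLatency σ
    exact ⟨le_antisymm (h3.trans h1) h2, le_antisymm h1 (h2.trans h3)⟩
  · obtain ⟨t₀, ht₀⟩ := hlex.eventually_stationary hτ hf
    refine ⟨t₀, fun t ht => ?_⟩
    obtain ⟨h1, h2, -⟩ := hlex.of_stationary hτ hf (ht₀ t ht)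
    have h3 := (hflow t).2
    exact ⟨fun e he => ⟨(hflow t).1 e he, h1 e he⟩, by omega, by omega⟩
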